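/- Let $G=(V,E)$ be a finite simple graph with a vertex $v$ of degree four such that the subgraph induced on the neighbourhood $\mathcal N_v$ is not isomorphic to the path graph $P_4$ on four vertices. Let $|G\rangle$ be the graph state of $G$, i.e. the $|V|$-qubit unit vector (unique up to a phase) with $g_i|G\rangle=|G\rangle$ for all $i\in V$, where $g_i=X_i\prod_{j\in\mathcal N_i}Z_j$ with the Pauli matrices $X,Z$. Then $|G\rangle$ cannot be generated in any network with bipartite sources whose parties are the vertices of $G$, each holding one qubit. Here a network with bipartite sources consists of finitely many sources $s$, each distributing its two subsystems to two distinct parties, and a state $\varrho$ can be generated in it if there are source states (density matrices) $\varrho_s$ on bipartite systems of arbitrary finite dimensions, a probability distribution $(p_\lambda)_\lambda$ of a discrete shared random variable, and for every $\lambda$ and every party $u$ a quantum channel (completely positive trace-preserving linear map) $\mathcal E_u^{(\lambda)}$ from the joint system of all subsystems received by $u$ to the qubit of $u$, such that $$\varrho=\sum_\lambda p_\lambda\Big(\bigotimes_{u\in V}\mathcal E_u^{(\lambda)}\Big)\Big[\bigotimes_s\varrho_s\Big],$$ where the subsystems of $\bigotimes_s\varrho_s$ are regrouped by party. The claim is that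 $\varrho=|G\rangle\langle G|$ is not of this form for any such network. -/

import Mathlib

namespace QuantumNetwork

open scoped ComplexOrder

/-- A density matrix: positive semidefinite with trace one. -/
def IsDensityMatrix {ι : Type*} [Fintype ι] (ρ : Matrix ι ι ℂ) : Prop :=
  ρ.PosSemidef ∧ ρ.trace = 1

/-- The ampliation `id_κ ⊗ E` of a linear map `E` between matrix algebras: `E` is applied to every
block of a block matrix. -/
def ampliation (κ : Type*) {ι o : Type*} (E : Matrix ι ι ℂ →ₗ[ℂ] Matrix o o ℂ)
    (M : Matrix (κ × ι) (κ × ι) ℂ) : Matrix (κ × o) (κ × o) ℂ :=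
  Matrix.of fun x y => E (Matrix.of fun a b => M (x.1, a) (y.1, b)) x.2 y.2

/-- A quantum channel: a completely positive trace preserving linear map. -/
def IsChannel {ι o : Type*} [Fintype ι] [Fintype o]
    (E : Matrix ι ι ℂ →ₗ[ℂ] Matrix o o ℂ) : Prop :=
  (∀ (k : ℕ) (M : Matrix (Fin k × ι) (Fin k × ι) ℂ),
      M.PosSemidef → (ampliation (Fin k) E M).PosSemidef) ∧
    ∀ M : Matrix ι ι ℂ, (E M).trace = M.trace

/-- The tensor product `⨂ v, A v` of a family of matrices. -/
def tensorMatrix {V : Type*} [Fintype V] {ι : V → Type*} (A : ∀ v, Matrix (ι v) (ι v) ℂ) :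
    Matrix (∀ v, ι v) (∀ v, ι v) ℂ :=
  Matrix.of fun x y => ∏ v, A v (x v) (y v)

/-- The tensor product `⨂ v, E v` of a family of linear maps between matrix algebras, applied to
`M = ∑ a b, M a b • ⨂ v, |a v⟩⟨b v|`. -/
def applyLocal {V : Type*} [Fintype V] [DecidableEq V] {ι o : V → Type*}
    [∀ v, Fintype (ι v)] [∀ v, DecidableEq (ι v)]
    (E : ∀ v, Matrix (ι v) (ι v) ℂ →ₗ[ℂ] Matrix (o v) (o v) ℂ)
    (M : Matrix (∀ v, ι v) (∀ v, ι v) ℂ) : Matrix (∀ v, o v) (∀ v, o v) ℂ :=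
  ∑ a, ∑ b, M a b • tensorMatrix fun v => E v (Matrix.single (a v) (b v) 1)

/-- A network on the set of parties `V` all of whose sources are bipartite: a finite collection of
sources, each of which sends its two subsystems to two distinct parties. Several sources may serve
the same pair of parties. -/
structure BipartiteNetwork (V : Type*) where
  /-- the sources -/
  Source : Type
  /-- there are finitely many sources -/
  fintypeSource : Fintype Source
  /-- equality of sources is decidable -/
  decEqSource : DecidableEq Source
  /-- the party that receives the `b`-th subsystem of a source -/
  node : Source → Fin 2 ↪ V

attribute [instance] BipartiteNetwork.fintypeSource BipartiteNetwork.decEqSource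

namespace BipartiteNetwork

variable {V : Type*} (N : BipartiteNetwork V)

/-- The basis labels of the joint system which party `v` receives from the sources, when the `b`-th
subsystem of source `s` has dimension `d s b`. -/
abbrev LocalIndex (d : N.Source → Fin 2 → ℕ) (v : V) : Type :=
  ∀ h : {h : N.Source × Fin 2 // N.node h.1 h.2 = v}, Fin (d h.1.1 h.1.2)

/-- The same global basis labels, sorted by parties and sorted by sources. -/
def regroup (d : N.Source → Fin 2 → ℕ) :
    (∀ v, N.LocalIndex d v) ≃ (∀ s b, Fin (d s b)) where
  toFun x s b := x (N.node s b) ⟨(s, b), rfl⟩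
  invFun y _ h := y h.1.1 h.1.2
  left_inv x := by
    funext v ⟨⟨s, b⟩, h⟩
    subst h
    rfl
  right_inv _ := rfl

/-- The tensor product of all source states, as a matrix on the systems sorted by parties. -/
def sourceState {d : N.Source → Fin 2 → ℕ}
    (σ : ∀ s, Matrix (∀ b, Fin (d s b)) (∀ b, Fin (d s b)) ℂ) :
    Matrix (∀ v, N.LocalIndex d v) (∀ v, N.LocalIndex d v) ℂ :=
  (tensorMatrix σ).submatrix (N.regroup d) (N.regroup d)

/-- The multi-qubit state `ρ` (one qubit per party) can be generated in the network `N` with local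
operations and shared randomness: there are source states `σ s` of finite dimension, a shared
random variable with values `l` of probability `p l`, and local channels `E l v` such that
`ρ = ∑ l, p l • (⨂ v, E l v) (⨂ s, σ s)`. -/
def Generates [Fintype V] [DecidableEq V] (ρ : Matrix (V → Fin 2) (V → Fin 2) ℂ) : Prop :=
  ∃ (d : N.Source → Fin 2 → ℕ)
    (σ : ∀ s, Matrix (∀ b, Fin (d s b)) (∀ b, Fin (d s b)) ℂ)
    (Λ : Type) (p : Λ → ℝ)
    (E : Λ → ∀ v, Matrix (N.LocalIndex d v) (N.LocalIndex d v) ℂ →ₗ[ℂ]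
      Matrix (Fin 2) (Fin 2) ℂ),
    (∀ s, IsDensityMatrix (σ s)) ∧
    (∀ l, 0 ≤ p l) ∧ HasSum p 1 ∧
    (∀ l v, IsChannel (E l v)) ∧
    HasSum (fun l => (p l : ℂ) • applyLocal (E l) (N.sourceState σ)) ρ

end BipartiteNetwork

/-- The Pauli matrix `σ_x`. -/
def pauliX : Matrix (Fin 2) (Fin 2) ℂ := !![0, 1; 1, 0]

/-- The Pauli matrix `σ_z`. -/
def pauliZ : Matrix (Fin 2) (Fin 2) ℂ := !![1, 0; 0, -1]

/-- The stabilizing operator of the vertex `i`: `X` on `i`, `Z` on the neighbours of `i`, and the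
identity on all other vertices. -/
def stabilizer {V : Type*} [Fintype V] [DecidableEq V] (G : SimpleGraph V) [DecidableRel G.Adj]
    (i : V) : Matrix (V → Fin 2) (V → Fin 2) ℂ :=
  tensorMatrix fun j => if j = i then pauliX else if G.Adj i j then pauliZ else 1

/-- `ψ` is the graph state of `G`: a unit vector which is a common `+1`-eigenvector of all the
stabilizing operators (it is unique up to a phase). -/
def IsGraphState {V : Type*} [Fintype V] [DecidableEq V] (G : SimpleGraph V) [DecidableRel G.Adj]
    (ψ : (V → Fin 2) → ℂ) : Prop :=
  star ψ ⬝ᵥ ψ = 1 ∧ ∀ i, (stabilizer G i).mulVec ψ = ψ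

/-- The density matrix `|ψ⟩⟨ψ|` of a unit vector `ψ`. -/
def pureState {ι : Type*} (ψ : ι → ℂ) : Matrix ι ι ℂ :=
  Matrix.vecMulVec ψ (star ψ)

end QuantumNetwork

namespace QuantumNetwork

open scoped ComplexOrder MatrixOrder
open Matrix

/-! A unitary has expectation of real part at most one, so every component of positive weight in the
mixture already satisfies the stabilizer relations; shared randomness can be dropped. Now cut a
source, i.e. replace its state by the product of its marginals. A product observable does not notice
this if it is trivial at one end of the source.

Take stabilizing product unitaries `S`, `T`, `R` and a set `A` as in `not_generates_of_stabilized`.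
Cut those sources crossing the boundary of `A` whose outer end sees a trivial `S`: both `S` and `T`
keep expectation one, hence so does `S * T`. Cut the remaining crossing sources: `S * T` is trivial
at their outer ends and still has expectation one. But the state now factorizes along `A`, and the
factor on `A` is the expectation of `S` restricted to `A`. It is the same as without cuts, where it
vanishes by anticommutation with `R`. So 1 = 0 (`false_of_stabilized`).

For graphs, if some `v` has nonadjacent neighbours `a`, `b`, the generators of `a`, `b`, `v` serve
as `S`, `T`, `R`. Otherwise all components are cliques, and products of generators in a clique work.
-/

/-! ### Tensor products, Choi matrices and positivity -/

theorem tensorMatrix_apply {V : Type*} [Fintype V] {ι : V → Type*} (A : ∀ v, Matrix (ι v) (ι v) ℂ)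
    (x y : ∀ v, ι v) : tensorMatrix A x y = ∏ v, A v (x v) (y v) := rfl

theorem tensorMatrix_mul {V : Type*} [Fintype V] [DecidableEq V] {ι : V → Type*}
    [∀ v, Fintype (ι v)] (A B : ∀ v, Matrix (ι v) (ι v) ℂ) :
    tensorMatrix A * tensorMatrix B = tensorMatrix fun v => A v * B v := by
  ext x y
  simp only [Matrix.mul_apply, tensorMatrix_apply, ← Finset.prod_mul_distrib]
  rw [Finset.prod_univ_sum, Fintype.piFinset_univ]

theorem tensorMatrix_one {V : Type*} [Fintype V] [DecidableEq V] {ι : V → Type*}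
    [∀ v, DecidableEq (ι v)] :
    (tensorMatrix fun v => (1 : Matrix (ι v) (ι v) ℂ)) = 1 := by
  ext x y
  simp only [tensorMatrix_apply, Matrix.one_apply, Finset.prod_ite_zero, Finset.mem_univ,
    true_imp_iff, Finset.prod_const_one, funext_iff]

theorem conjTranspose_tensorMatrix {V : Type*} [Fintype V] {ι : V → Type*}
    (A : ∀ v, Matrix (ι v) (ι v) ℂ) :
    (tensorMatrix A)ᴴ = tensorMatrix fun v => (A v)ᴴ := by
  ext x y
  simp [tensorMatrix_apply, Matrix.conjTranspose_apply]

theorem trace_tensorMatrix {V : Type*} [Fintype V] [DecidableEq V] {ι : V → Type*}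
    [∀ v, Fintype (ι v)] (A : ∀ v, Matrix (ι v) (ι v) ℂ) :
    (tensorMatrix A).trace = ∏ v, (A v).trace := by
  simp only [Matrix.trace, Matrix.diag_apply, tensorMatrix_apply]
  rw [Finset.prod_univ_sum, Fintype.piFinset_univ]

/-- Iterated Schur product theorem, starting from the all-ones matrix. Tensor products are the case
of factors pulled back along coordinate projections. -/
theorem posSemidef_prod {κ α : Type*} (s : Finset κ) (A : κ → Matrix α α ℂ)
    (hA : ∀ k ∈ s, (A k).PosSemidef) :
    (Matrix.of fun x y => ∏ k ∈ s, A k x y).PosSemidef := by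
  classical
  induction s using Finset.induction_on with
  | empty =>
    have h := Matrix.posSemidef_conjTranspose_mul_self (Matrix.of fun (_ : Unit) (_ : Unit) => (1 : ℂ))
    have key : (Matrix.of fun x y : α => ∏ k ∈ (∅ : Finset κ), A k x y) =
        ((Matrix.of fun (_ : Unit) (_ : Unit) => (1 : ℂ))ᴴ *
          Matrix.of fun (_ : Unit) (_ : Unit) => (1 : ℂ)).submatrix (fun _ => ()) fun _ => () := by
      ext x y
      simp [Matrix.mul_apply]
    rw [key]
    exact h.submatrix _
  | insert a s ha ih =>
    have h := (hA a (Finset.mem_insert_self a s)).hadamard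
      (ih fun k hk => hA k (Finset.mem_insert_of_mem hk))
    have key : (Matrix.of fun x y : α => ∏ k ∈ insert a s, A k x y) =
        Matrix.hadamard (A a) (Matrix.of fun x y => ∏ k ∈ s, A k x y) := by
      ext x y
      simp [Finset.prod_insert ha, Matrix.hadamard_apply]
    rw [key]
    exact h

theorem posSemidef_tensorMatrix {V : Type*} [Fintype V] {ι : V → Type*}
    {A : ∀ v, Matrix (ι v) (ι v) ℂ} (hA : ∀ v, (A v).PosSemidef) :
    (tensorMatrix A).PosSemidef :=
  posSemidef_prod Finset.univ (fun v => (A v).submatrix (fun x : ∀ v, ι v => x v) fun x => x v)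
    fun v _ => (hA v).submatrix _

/-- The Choi matrix of a linear map between matrix algebras. -/
def choi {ι o : Type*} [DecidableEq ι] (E : Matrix ι ι ℂ →ₗ[ℂ] Matrix o o ℂ) :
    Matrix (ι × o) (ι × o) ℂ :=
  Matrix.of fun x y => E (Matrix.single x.1 y.1 1) x.2 y.2

theorem IsChannel.posSemidef_choi {ι o : Type*} [Fintype ι] [DecidableEq ι] [Fintype o]
    {E : Matrix ι ι ℂ →ₗ[ℂ] Matrix o o ℂ} (hE : IsChannel E) : (choi E).PosSemidef := by
  let e := Fintype.equivFin ι
  -- The unnormalized maximally entangled vector; its ampliated image is the Choi matrix.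
  let w : Fin (Fintype.card ι) × ι → ℂ := fun x => if e x.2 = x.1 then 1 else 0
  have h := (hE.1 _ _ (Matrix.posSemidef_vecMulVec_self_star w)).submatrix
    (fun x : ι × o => (e x.1, x.2))
  refine Eq.subst (motive := Matrix.PosSemidef) ?_ h
  symm
  ext x y
  simp only [choi, ampliation, Matrix.submatrix_apply, Matrix.of_apply]
  refine congrFun (congrFun (congrArg (fun M => E M) ?_) _) _
  ext a b
  simp only [w, Matrix.single_apply, Matrix.of_apply, Matrix.vecMulVec_apply, Pi.star_apply,
    EmbeddingLike.apply_eq_iff_eq]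
  by_cases h1 : x.1 = a <;> by_cases h2 : y.1 = b <;> simp [h1, h2] <;> aesop

theorem posSemidef_applyLocal {V : Type*} [Fintype V] [DecidableEq V] {ι o : V → Type*}
    [∀ v, Fintype (ι v)] [∀ v, DecidableEq (ι v)] [∀ v, Fintype (o v)] [∀ v, DecidableEq (o v)]
    {E : ∀ v, Matrix (ι v) (ι v) ℂ →ₗ[ℂ] Matrix (o v) (o v) ℂ} (hE : ∀ v, IsChannel (E v))
    {M : Matrix (∀ v, ι v) (∀ v, ι v) ℂ} (hM : M.PosSemidef) : (applyLocal E M).PosSemidef := by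
  have hC := posSemidef_tensorMatrix fun v => (hE v).posSemidef_choi
  -- The output is a sum over input labels of entries of `M` times the tensored Choi matrices: a
  -- Hadamard product, then compressed by a 0-1 matrix that forgets the input labels.
  have hQ := (hM.submatrix (Prod.fst : (∀ v, ι v) × (∀ v, o v) → _)).hadamard
    (hC.submatrix fun (p : (∀ v, ι v) × (∀ v, o v)) v => (p.1 v, p.2 v))
  have h := hQ.conjTranspose_mul_mul_same
    (Matrix.of fun (p : (∀ v, ι v) × (∀ v, o v)) (x : ∀ v, o v) => if p.2 = x then (1 : ℂ) else 0)
  refine Eq.subst (motive := Matrix.PosSemidef) ?_ h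
  symm
  ext x y
  simp only [applyLocal, Matrix.sum_apply, Matrix.smul_apply, tensorMatrix_apply,
    Matrix.mul_apply, Matrix.conjTranspose_apply, Matrix.of_apply, Matrix.hadamard_apply,
    Matrix.submatrix_apply, choi, Fintype.sum_prod_type, smul_eq_mul, apply_ite star, star_one,
    star_zero, ite_mul, one_mul, zero_mul, mul_ite, mul_one, mul_zero, Finset.sum_ite_eq',
    Finset.mem_univ, if_true]
  exact Finset.sum_comm

/-! ### Expectations of unitaries -/

section Unitary

variable {ι : Type*} [Fintype ι] [DecidableEq ι]

theorem trace_sub_unitary {η U : Matrix ι ι ℂ} (hη : IsDensityMatrix η) (hU : Uᴴ * U = 1) :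
    ((1 - U) * η * (1 - U)ᴴ).trace = 2 - 2 * ((η * U).trace.re : ℂ) := by
  have h1 : (U * η * Uᴴ).trace = 1 := by
    rw [Matrix.trace_mul_comm, ← Matrix.mul_assoc, hU, Matrix.one_mul, hη.2]
  have h2 : (η * Uᴴ).trace = star (η * U).trace := by
    rw [← Matrix.trace_conjTranspose, Matrix.conjTranspose_mul, hη.1.1.eq, Matrix.trace_mul_comm]
  have h3 : (1 - U) * η * (1 - U)ᴴ = η - U * η - η * Uᴴ + U * η * Uᴴ := by
    rw [Matrix.conjTranspose_sub, Matrix.conjTranspose_one]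
    noncomm_ring
  rw [h3, Matrix.trace_add, Matrix.trace_sub, Matrix.trace_sub, h1, h2, hη.2,
    Matrix.trace_mul_comm U]
  apply Complex.ext
  · simp
    ring
  · simp

theorem re_trace_mul_unitary_le {η U : Matrix ι ι ℂ} (hη : IsDensityMatrix η) (hU : Uᴴ * U = 1) :
    (η * U).trace.re ≤ 1 := by
  have h := (hη.1.mul_mul_conjTranspose_same (1 - U)).trace_nonneg
  rw [trace_sub_unitary hη hU] at h
  have := (Complex.le_def.1 h).1
  simp at this
  linarith

theorem unitary_mul_eq_of_re_trace_eq_one {η U : Matrix ι ι ℂ} (hη : IsDensityMatrix η)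
    (hU : Uᴴ * U = 1) (h : (η * U).trace.re = 1) : U * η = η := by
  have h0 : ((1 - U) * η * (1 - U)ᴴ).trace = 0 := by
    rw [trace_sub_unitary hη hU, h]; norm_num
  -- With `η = Bᴴ * B`, the vanishing trace is the squared Hilbert–Schmidt norm of `B * (1 - U)ᴴ`.
  obtain ⟨B, hB⟩ := CStarAlgebra.nonneg_iff_eq_star_mul_self.mp hη.1.nonneg
  rw [Matrix.star_eq_conjTranspose] at hB
  have h1 : (1 - U) * η * (1 - U)ᴴ = (B * (1 - U)ᴴ)ᴴ * (B * (1 - U)ᴴ) := by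
    rw [Matrix.conjTranspose_mul, Matrix.conjTranspose_conjTranspose, hB]
    simp only [Matrix.mul_assoc]
  rw [h1, Matrix.trace_conjTranspose_mul_self_eq_zero_iff] at h0
  have h2 : (1 - U) * η = 0 := by
    rw [hB, ← Matrix.mul_assoc]
    have := congrArg Matrix.conjTranspose h0
    rw [Matrix.conjTranspose_mul, Matrix.conjTranspose_conjTranspose,
      Matrix.conjTranspose_zero] at this
    rw [this, Matrix.zero_mul]
  rw [Matrix.sub_mul, Matrix.one_mul, sub_eq_zero] at h2
  exact h2.symm

theorem trace_mul_mul_eq_one {η S T : Matrix ι ι ℂ} (hη : IsDensityMatrix η)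
    (hS : Sᴴ * S = 1) (hT : Tᴴ * T = 1) (h1 : (η * S).trace.re = 1)
    (h2 : (η * T).trace.re = 1) :
    (η * (S * T)).trace = 1 := by
  have hs := unitary_mul_eq_of_re_trace_eq_one hη hS h1
  have ht := unitary_mul_eq_of_re_trace_eq_one hη hT h2
  rw [Matrix.trace_mul_comm, Matrix.mul_assoc, ht, hs, hη.2]

/-- Since `R` fixes `η` from both sides, moving it past `P` shows that the expectation equals its
own negative. -/
theorem trace_mul_eq_zero_of_anticommute {η R P : Matrix ι ι ℂ} (hη : IsDensityMatrix η)
    (hR : Rᴴ * R = 1) (h1 : (η * R).trace.re = 1) (hRP : R * P = -(P * R)) :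
    (η * P).trace = 0 := by
  have hr := unitary_mul_eq_of_re_trace_eq_one hη hR h1
  have hr' : η * R = η := by
    have h := congrArg Matrix.conjTranspose hr
    rw [Matrix.conjTranspose_mul, hη.1.1.eq] at h
    calc η * R = η * Rᴴ * R := by rw [h]
      _ = η := by rw [Matrix.mul_assoc, hR, Matrix.mul_one]
  have h2 : (η * P).trace = -(η * P).trace := by
    calc (η * P).trace = (η * R * P).trace := by rw [hr']
      _ = -(η * P * R).trace := by
        rw [Matrix.mul_assoc, hRP, Matrix.mul_neg, Matrix.trace_neg, Matrix.mul_assoc]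
      _ = -(η * P).trace := by
        rw [Matrix.trace_mul_comm, ← Matrix.mul_assoc, hr]
  linear_combination h2 / 2

end Unitary

/-! ### Product observables and factorization -/

section Pairing

variable {V : Type*} [Fintype V] [DecidableEq V] {ι : V → Type*} [∀ v, Fintype (ι v)]
  [∀ v, DecidableEq (ι v)]

/-- The pairing `∑ a b, M a b * ∏ v, G v (a v) (b v)` of a multipartite matrix with a family of
local matrices. -/
def pairing (M : Matrix (∀ v, ι v) (∀ v, ι v) ℂ) (G : ∀ v, Matrix (ι v) (ι v) ℂ) : ℂ :=
  ∑ a, ∑ b, M a b * ∏ v, G v (a v) (b v)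

/-- The observable `O` pulled back along `E`, up to transposition. -/
def response {ι o : Type*} [DecidableEq ι] [Fintype o] (E : Matrix ι ι ℂ →ₗ[ℂ] Matrix o o ℂ)
    (O : Matrix o o ℂ) : Matrix ι ι ℂ :=
  Matrix.of fun a b => (E (Matrix.single a b 1) * O).trace

theorem IsChannel.response_one {ι o : Type*} [Fintype ι] [DecidableEq ι] [Fintype o]
    [DecidableEq o] {E : Matrix ι ι ℂ →ₗ[ℂ] Matrix o o ℂ} (hE : IsChannel E) :
    response E 1 = 1 := by
  ext a b
  rw [response, Matrix.of_apply, Matrix.mul_one, hE.2]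
  by_cases h : a = b
  · subst h; simp
  · simp [h]

theorem trace_applyLocal_mul {o : V → Type*} [∀ v, Fintype (o v)]
    (E : ∀ v, Matrix (ι v) (ι v) ℂ →ₗ[ℂ] Matrix (o v) (o v) ℂ)
    (M : Matrix (∀ v, ι v) (∀ v, ι v) ℂ) (O : ∀ v, Matrix (o v) (o v) ℂ) :
    (applyLocal E M * tensorMatrix O).trace = pairing M fun v => response (E v) (O v) := by
  simp only [applyLocal, Finset.sum_mul, Matrix.trace_sum, Matrix.smul_mul, Matrix.trace_smul,
    tensorMatrix_mul, trace_tensorMatrix, pairing, response, Matrix.of_apply, smul_eq_mul]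

theorem pairing_one (M : Matrix (∀ v, ι v) (∀ v, ι v) ℂ) : pairing M (fun _ => 1) = M.trace := by
  have h : ∀ a b : ∀ v, ι v, (∏ v, (1 : Matrix (ι v) (ι v) ℂ) (a v) (b v)) =
      if a = b then 1 else 0 := fun a b => by
    rw [← Matrix.one_apply, ← tensorMatrix_one]; rfl
  simp [pairing, h, Matrix.trace]

theorem isDensityMatrix_applyLocal {o : V → Type*} [∀ v, Fintype (o v)] [∀ v, DecidableEq (o v)]
    {E : ∀ v, Matrix (ι v) (ι v) ℂ →ₗ[ℂ] Matrix (o v) (o v) ℂ} (hE : ∀ v, IsChannel (E v))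
    {M : Matrix (∀ v, ι v) (∀ v, ι v) ℂ} (hM : IsDensityMatrix M) :
    IsDensityMatrix (applyLocal E M) := by
  refine ⟨posSemidef_applyLocal hE hM.1, ?_⟩
  have h := trace_applyLocal_mul E M fun v => 1
  rw [tensorMatrix_one, Matrix.mul_one] at h
  rw [h, ← hM.2, ← pairing_one]
  simp only [(hE _).response_one]

/-- The labels of `a` on `A` and those of `b` elsewhere. -/
def mix (A : Finset V) (a b : ∀ v, ι v) : ∀ v, ι v := fun v => if v ∈ A then a v else b v

theorem mix_of_mem {A : Finset V} {v : V} (h : v ∈ A) (a b : ∀ v, ι v) : mix A a b v = a v :=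
  if_pos h

theorem mix_of_notMem {A : Finset V} {v : V} (h : v ∉ A) (a b : ∀ v, ι v) : mix A a b v = b v :=
  if_neg h

/-- Exchanging two labels outside `A`. -/
def mixEquiv (A : Finset V) : (∀ v, ι v) × (∀ v, ι v) ≃ (∀ v, ι v) × (∀ v, ι v) where
  toFun p := (mix A p.1 p.2, mix A p.2 p.1)
  invFun p := (mix A p.1 p.2, mix A p.2 p.1)
  left_inv p := by ext v <;> by_cases h : v ∈ A <;> simp [mix, h]
  right_inv p := by ext v <;> by_cases h : v ∈ A <;> simp [mix, h]

theorem pairing_mul_pairing (M : Matrix (∀ v, ι v) (∀ v, ι v) ℂ) (G H : ∀ v, Matrix (ι v) (ι v) ℂ) :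
    pairing M G * pairing M H = ∑ p : (∀ v, ι v) × (∀ v, ι v), ∑ q : (∀ v, ι v) × (∀ v, ι v),
      (M p.1 q.1 * M p.2 q.2) * ∏ v, (G v (p.1 v) (q.1 v) * H v (p.2 v) (q.2 v)) := by
  simp only [pairing, Fintype.sum_prod_type, Finset.sum_mul_sum, Finset.prod_mul_distrib]
  refine Finset.sum_congr rfl fun a _ => Finset.sum_congr rfl fun a' _ => ?_
  refine Finset.sum_congr rfl fun b _ => Finset.sum_congr rfl fun b' _ => ?_
  ring

/-- Swap trick: write both products as sums over two copies of the labels and exchange the copies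
outside `A`; `hM` says that the entries of `M` do not notice. For a state, the extra factor on the
left is the trace, i.e. one. -/
theorem pairing_factor (A : Finset V) {M : Matrix (∀ v, ι v) (∀ v, ι v) ℂ}
    (hM : ∀ a a' b b', M (mix A a a') (mix A b b') * M (mix A a' a) (mix A b' b) =
      M a b * M a' b') (G : ∀ v, Matrix (ι v) (ι v) ℂ) :
    pairing M G * pairing M (fun _ => 1) =
      pairing M (fun v => if v ∈ A then G v else 1) *
        pairing M (fun v => if v ∈ A then 1 else G v) := by
  rw [pairing_mul_pairing, pairing_mul_pairing]
  refine Fintype.sum_equiv (mixEquiv A) _ _ fun p => Fintype.sum_equiv (mixEquiv A) _ _ fun q => ?_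
  simp only [mixEquiv, Equiv.coe_fn_mk, hM]
  congr 1
  refine Finset.prod_congr rfl fun v _ => ?_
  by_cases h : v ∈ A
  · simp only [if_pos h, mix_of_mem h]
  · simp only [if_neg h, mix_of_notMem h]
    exact mul_comm _ _

end Pairing

/-! ### Cutting a bipartite state -/

section Cut

variable {d : Fin 2 → ℕ}

/-- A basis label of a bipartite system. -/
def pair (i : Fin (d 0)) (j : Fin (d 1)) : ∀ b, Fin (d b) :=
  (piFinTwoEquiv fun b => Fin (d b)).symm (i, j)

@[simp] theorem pair_zero (i : Fin (d 0)) (j : Fin (d 1)) : pair i j 0 = i := rfl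

@[simp] theorem pair_one (i : Fin (d 0)) (j : Fin (d 1)) : pair i j 1 = j := rfl

theorem update_zero (x : ∀ b, Fin (d b)) (k : Fin (d 0)) :
    Function.update x 0 k = pair k (x 1) := by
  funext b; fin_cases b <;> simp

theorem update_one (x : ∀ b, Fin (d b)) (k : Fin (d 1)) :
    Function.update x 1 k = pair (x 0) k := by
  funext b; fin_cases b <;> simp

theorem sum_pair (f : (∀ b, Fin (d b)) → ℂ) : ∑ x, f x = ∑ i, ∑ j, f (pair i j) := by
  rw [← Fintype.sum_prod_type']
  exact (Fintype.sum_equiv (piFinTwoEquiv fun b => Fin (d b)).symm _ _ fun _ => rfl).symm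

/-- The product of the two marginals of a bipartite state. -/
def cut (σ : Matrix (∀ b, Fin (d b)) (∀ b, Fin (d b)) ℂ) :
    Matrix (∀ b, Fin (d b)) (∀ b, Fin (d b)) ℂ :=
  Matrix.of fun x y => (∑ k, σ (pair (x 0) k) (pair (y 0) k)) *
    ∑ k, σ (pair k (x 1)) (pair k (y 1))

theorem isDensityMatrix_cut {σ : Matrix (∀ b, Fin (d b)) (∀ b, Fin (d b)) ℂ}
    (hσ : IsDensityMatrix σ) : IsDensityMatrix (cut σ) := by
  constructor
  · have h0 := Matrix.posSemidef_sum Finset.univ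
      fun k _ => hσ.1.submatrix fun x : ∀ b, Fin (d b) => pair (x 0) k
    have h1 := Matrix.posSemidef_sum Finset.univ
      fun k _ => hσ.1.submatrix fun x : ∀ b, Fin (d b) => pair k (x 1)
    refine Eq.subst (motive := Matrix.PosSemidef) ?_ (h0.hadamard h1)
    ext x y
    simp [cut, Matrix.hadamard_apply, Matrix.sum_apply]
  · have h := hσ.2
    simp only [Matrix.trace, Matrix.diag_apply, sum_pair] at h
    simp only [Matrix.trace, Matrix.diag_apply, cut, Matrix.of_apply, sum_pair, pair_zero, pair_one,
      ← Finset.sum_mul_sum]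
    rw [h, Finset.sum_comm, h, one_mul]

/-- Both marginals survive the cut: the marginal being summed away contributes only its trace, which
is one. -/
theorem sum_update_cut {σ : Matrix (∀ b, Fin (d b)) (∀ b, Fin (d b)) ℂ}
    (hσ : IsDensityMatrix σ) (b : Fin 2) (x y : ∀ b, Fin (d b)) :
    ∑ k, cut σ (Function.update x b k) (Function.update y b k) =
      ∑ k, σ (Function.update x b k) (Function.update y b k) := by
  have h := hσ.2
  simp only [Matrix.trace, Matrix.diag_apply, sum_pair] at h
  fin_cases b
  · simp only [Fin.zero_eta, update_zero, cut, Matrix.of_apply, pair_zero, pair_one,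
      ← Finset.sum_mul]
    rw [h, one_mul]
  · simp only [Fin.mk_one, update_one, cut, Matrix.of_apply, pair_zero, pair_one,
      ← Finset.mul_sum]
    rw [Finset.sum_comm, h, mul_one]

end Cut

/-! ### Changing source states in a network -/

namespace BipartiteNetwork

variable {V : Type*} [Fintype V] [DecidableEq V] (N : BipartiteNetwork V)
  {d : N.Source → Fin 2 → ℕ}

/-- Replace the label of the `b`-th subsystem of the source `s` by `k`. -/
def relabel (s : N.Source) (b : Fin 2) (a : ∀ v, N.LocalIndex d v) (k : Fin (d s b)) :
    ∀ v, N.LocalIndex d v :=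
  Function.update a (N.node s b) (Function.update (a (N.node s b)) ⟨(s, b), rfl⟩ k)

omit [Fintype V] in
theorem relabel_apply_of_ne {s : N.Source} {b : Fin 2} (a : ∀ v, N.LocalIndex d v)
    (k : Fin (d s b)) {v : V} (h : {h : N.Source × Fin 2 // N.node h.1 h.2 = v})
    (hne : h.1 ≠ (s, b)) : N.relabel s b a k v h = a v h := by
  unfold relabel
  by_cases hv : v = N.node s b
  · subst hv
    rw [Function.update_self, Function.update_of_ne]
    exact fun h' => hne (congrArg Subtype.val h')
  · rw [Function.update_of_ne hv]

theorem regroup_relabel_self (s : N.Source) (b : Fin 2) (a : ∀ v, N.LocalIndex d v)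
    (k : Fin (d s b)) :
    N.regroup d (N.relabel s b a k) s = Function.update (N.regroup d a s) b k := by
  funext b'
  by_cases hb : b' = b
  · subst hb
    simp [regroup, relabel]
  · rw [Function.update_of_ne hb]
    exact N.relabel_apply_of_ne a k _ fun h => hb (Prod.ext_iff.1 h).2

theorem regroup_relabel_of_ne {s t : N.Source} (hts : t ≠ s) (b : Fin 2)
    (a : ∀ v, N.LocalIndex d v) (k : Fin (d s b)) :
    N.regroup d (N.relabel s b a k) t = N.regroup d a t := by
  funext b'
  exact N.relabel_apply_of_ne a k _ fun h => hts (Prod.ext_iff.1 h).1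

/-- Exchange a label with the label of the `b`-th subsystem of the source `s`. -/
def relabelEquiv (s : N.Source) (b : Fin 2) :
    (∀ v, N.LocalIndex d v) × Fin (d s b) ≃ (∀ v, N.LocalIndex d v) × Fin (d s b) :=
  Function.Involutive.toPerm
    (fun p => (N.relabel s b p.1 p.2, p.1 (N.node s b) ⟨(s, b), rfl⟩)) fun p => by
      simp [relabel]

/-- Exchanging the label in `a` with the spare label `k` is a bijection. This isolates one
subsystem's label without splitting the dependent product type. -/
theorem sum_relabel (s : N.Source) (b : Fin 2) (g : (∀ v, N.LocalIndex d v) → ℂ) :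
    ∑ a, ∑ k, g (N.relabel s b a k) = d s b * ∑ a, g a := by
  have h : ∑ p : (∀ v, N.LocalIndex d v) × Fin (d s b), g (N.relabel s b p.1 p.2) =
      ∑ p : (∀ v, N.LocalIndex d v) × Fin (d s b), g p.1 :=
    Fintype.sum_equiv (N.relabelEquiv s b) _ _ fun _ => rfl
  simp only [Fintype.sum_prod_type] at h
  rw [h]
  simp [Finset.mul_sum]

/-- The identity at the receiving party forces `k = l`, and only `σ s` depends on `k`. Summation
over `k` therefore produces a partial trace of `σ s`. -/
theorem pairing_sourceState_apply_relabel {s : N.Source} {b : Fin 2}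
    (σ : ∀ s, Matrix (∀ b, Fin (d s b)) (∀ b, Fin (d s b)) ℂ)
    {G : ∀ v, Matrix (N.LocalIndex d v) (N.LocalIndex d v) ℂ} (hG : G (N.node s b) = 1)
    (x y : ∀ v, N.LocalIndex d v) (k l : Fin (d s b)) :
    N.sourceState σ (N.relabel s b x k) (N.relabel s b y l) *
        ∏ v, G v (N.relabel s b x k v) (N.relabel s b y l v) =
      if k = l then ((∏ t ∈ Finset.univ.erase s, σ t (N.regroup d x t) (N.regroup d y t)) *
        ((∏ v ∈ Finset.univ.erase (N.node s b), G v (x v) (y v)) *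
          if ∀ h : {h : N.Source × Fin 2 // N.node h.1 h.2 = N.node s b},
            h.1 ≠ (s, b) → x _ h = y _ h then 1 else 0)) *
        σ s (Function.update (N.regroup d x s) b k) (Function.update (N.regroup d y s) b k)
      else 0 := by
  have h1 : N.sourceState σ (N.relabel s b x k) (N.relabel s b y l) =
      σ s (Function.update (N.regroup d x s) b k) (Function.update (N.regroup d y s) b l) *
        ∏ t ∈ Finset.univ.erase s, σ t (N.regroup d x t) (N.regroup d y t) := by
    rw [sourceState, Matrix.submatrix_apply, tensorMatrix_apply,
      ← Finset.mul_prod_erase _ _ (Finset.mem_univ s), N.regroup_relabel_self,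
      N.regroup_relabel_self]
    congr 1
    refine Finset.prod_congr rfl fun t ht => ?_
    rw [N.regroup_relabel_of_ne (Finset.ne_of_mem_erase ht),
      N.regroup_relabel_of_ne (Finset.ne_of_mem_erase ht)]
  have h2 : ∏ v, G v (N.relabel s b x k v) (N.relabel s b y l v) =
      (if N.relabel s b x k (N.node s b) = N.relabel s b y l (N.node s b) then 1 else 0) *
        ∏ v ∈ Finset.univ.erase (N.node s b), G v (x v) (y v) := by
    rw [← Finset.mul_prod_erase _ _ (Finset.mem_univ (N.node s b)), hG, Matrix.one_apply]
    congr 1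
    refine Finset.prod_congr rfl fun v hv => ?_
    rw [relabel, relabel, Function.update_of_ne (Finset.ne_of_mem_erase hv),
      Function.update_of_ne (Finset.ne_of_mem_erase hv)]
  have h3 : N.relabel s b x k (N.node s b) = N.relabel s b y l (N.node s b) ↔
      k = l ∧ ∀ h : {h : N.Source × Fin 2 // N.node h.1 h.2 = N.node s b},
        h.1 ≠ (s, b) → x _ h = y _ h := by
    constructor
    · intro h
      refine ⟨?_, fun g hg => ?_⟩
      · simpa [relabel] using congrFun h ⟨(s, b), rfl⟩
      · have := congrFun h g
        rwa [N.relabel_apply_of_ne _ _ _ hg, N.relabel_apply_of_ne _ _ _ hg] at this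
    · rintro ⟨rfl, h⟩
      funext g
      by_cases hg : g.1 = (s, b)
      · obtain ⟨g, hg'⟩ := g
        subst hg
        simp [relabel]
      · rw [N.relabel_apply_of_ne _ _ _ hg, N.relabel_apply_of_ne _ _ _ hg, h g hg]
  rw [h1, h2]
  by_cases hkl : k = l
  · subst hkl
    simp only [h3, true_and, if_true]
    ring
  · simp [h3, hkl]

/-- Replacing the state of one source does not change the pairing if only the subsystem sent to a
party which ignores its input is affected. -/
theorem pairing_sourceState_congr_single {s : N.Source} {b : Fin 2}
    {σ τ : ∀ s, Matrix (∀ b, Fin (d s b)) (∀ b, Fin (d s b)) ℂ}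
    {G : ∀ v, Matrix (N.LocalIndex d v) (N.LocalIndex d v) ℂ} (hG : G (N.node s b) = 1)
    (hne : ∀ t ≠ s, σ t = τ t)
    (heq : ∀ x y, ∑ k, σ s (Function.update x b k) (Function.update y b k) =
      ∑ k, τ s (Function.update x b k) (Function.update y b k)) :
    pairing (N.sourceState σ) G = pairing (N.sourceState τ) G := by
  -- One factor `d s b` arises from relabelling the rows, the other from the columns.
  have key : ∀ σ : ∀ s, Matrix (∀ b, Fin (d s b)) (∀ b, Fin (d s b)) ℂ,
      (d s b : ℂ) * (d s b * pairing (N.sourceState σ) G) =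
      ∑ x : ∀ v, N.LocalIndex d v, ∑ y : ∀ v, N.LocalIndex d v,
        ((∏ t ∈ Finset.univ.erase s, σ t (N.regroup d x t) (N.regroup d y t)) *
        ((∏ v ∈ Finset.univ.erase (N.node s b), G v (x v) (y v)) *
          if ∀ h : {h : N.Source × Fin 2 // N.node h.1 h.2 = N.node s b},
            h.1 ≠ (s, b) → x _ h = y _ h then 1 else 0)) *
        ∑ k, σ s (Function.update (N.regroup d x s) b k)
          (Function.update (N.regroup d y s) b k) := by
    intro σ
    rw [pairing, ← N.sum_relabel s b, Finset.mul_sum]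
    refine Finset.sum_congr rfl fun x _ => ?_
    rw [Finset.mul_sum, Finset.sum_congr rfl fun k _ => (N.sum_relabel s b _).symm,
      Finset.sum_comm]
    refine Finset.sum_congr rfl fun y _ => ?_
    simp_rw [N.pairing_sourceState_apply_relabel σ hG, Finset.sum_ite_eq, Finset.mem_univ, if_true,
      Finset.mul_sum]
  have h : (d s b : ℂ) * (d s b * pairing (N.sourceState σ) G) =
      (d s b : ℂ) * (d s b * pairing (N.sourceState τ) G) := by
    rw [key, key]
    refine Finset.sum_congr rfl fun x _ => Finset.sum_congr rfl fun y _ => ?_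
    rw [heq]
    congr 2
    exact Finset.prod_congr rfl fun t ht => by rw [hne t (Finset.ne_of_mem_erase ht)]
  -- The factors cancel only in positive dimension; otherwise both pairings are empty sums.
  by_cases hd : d s b = 0
  · have : IsEmpty (∀ v, N.LocalIndex d v) :=
      ⟨fun x => (hd ▸ x (N.node s b) ⟨(s, b), rfl⟩ : Fin 0).elim0⟩
    simp [pairing]
  · have hd' : (d s b : ℂ) ≠ 0 := Nat.cast_ne_zero.2 hd
    exact mul_left_cancel₀ hd' (mul_left_cancel₀ hd' h)

theorem pairing_sourceState_congr
    {σ τ : ∀ s, Matrix (∀ b, Fin (d s b)) (∀ b, Fin (d s b)) ℂ}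
    {G : ∀ v, Matrix (N.LocalIndex d v) (N.LocalIndex d v) ℂ}
    (h : ∀ s, σ s = τ s ∨ ∃ b, G (N.node s b) = 1 ∧
      ∀ x y, ∑ k, σ s (Function.update x b k) (Function.update y b k) =
        ∑ k, τ s (Function.update x b k) (Function.update y b k)) :
    pairing (N.sourceState σ) G = pairing (N.sourceState τ) G := by
  -- Hybrid argument: the sources are exchanged one at a time.
  have key : ∀ T : Finset N.Source, pairing (N.sourceState σ) G =
      pairing (N.sourceState fun s => if s ∈ T then τ s else σ s) G := by
    intro T
    induction T using Finset.induction_on with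
    | empty => simp
    | insert s T hs ih =>
      rw [ih]
      rcases h s with h | ⟨b, hG, h⟩
      · congr 2
        funext t
        by_cases ht : t = s
        · subst ht; simp [hs, h]
        · simp [ht]
      · refine N.pairing_sourceState_congr_single hG (fun t ht => by simp [ht]) ?_
        simpa [hs] using h
  simpa using key Finset.univ

theorem isDensityMatrix_sourceState {σ : ∀ s, Matrix (∀ b, Fin (d s b)) (∀ b, Fin (d s b)) ℂ}
    (hσ : ∀ s, IsDensityMatrix (σ s)) : IsDensityMatrix (N.sourceState σ) := by
  refine ⟨(posSemidef_tensorMatrix fun s => (hσ s).1).submatrix _, ?_⟩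
  have h := trace_tensorMatrix σ
  rw [Finset.prod_congr rfl fun s _ => (hσ s).2, Finset.prod_const_one] at h
  rw [← h]
  exact Fintype.sum_equiv (N.regroup d) _ _ fun _ => rfl

omit [Fintype V] in
theorem regroup_mix (A : Finset V) (a b : ∀ v, N.LocalIndex d v) (s : N.Source) (i : Fin 2) :
    N.regroup d (mix A a b) s i =
      if N.node s i ∈ A then N.regroup d a s i else N.regroup d b s i := by
  by_cases h : N.node s i ∈ A <;> simp [regroup, mix, h]

/-- If every source which connects `A` with its complement is in a product state, then the joint
state factorizes along `A`. -/
theorem sourceState_mix_mul (A : Finset V)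
    {σ : ∀ s, Matrix (∀ b, Fin (d s b)) (∀ b, Fin (d s b)) ℂ}
    (h : ∀ s, (N.node s 0 ∈ A ↔ N.node s 1 ∈ A) ∨
      ∃ (f : Matrix (Fin (d s 0)) (Fin (d s 0)) ℂ) (g : Matrix (Fin (d s 1)) (Fin (d s 1)) ℂ),
        ∀ x y, σ s x y = f (x 0) (y 0) * g (x 1) (y 1))
    (a a' b b' : ∀ v, N.LocalIndex d v) :
    N.sourceState σ (mix A a a') (mix A b b') * N.sourceState σ (mix A a' a) (mix A b' b) =
      N.sourceState σ a b * N.sourceState σ a' b' := by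
  simp only [sourceState, Matrix.submatrix_apply, tensorMatrix_apply, ← Finset.prod_mul_distrib]
  refine Finset.prod_congr rfl fun s _ => ?_
  rcases h s with h | ⟨f, g, h⟩
  · by_cases h0 : N.node s 0 ∈ A
    · have hr : ∀ a b, N.regroup d (mix A a b) s = N.regroup d a s := fun a b => by
        funext i; rw [regroup_mix]; fin_cases i <;> simp [h0, h.1 h0]
      simp only [hr]
    · have hr : ∀ a b, N.regroup d (mix A a b) s = N.regroup d b s := fun a b => by
        funext i; rw [regroup_mix]; fin_cases i <;> simp [h0, mt h.2 h0]
      simp only [hr]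
      exact mul_comm _ _
  -- For a product source the two ends can be swapped independently between the copies.
  · simp only [h, regroup_mix]
    by_cases h0 : N.node s 0 ∈ A <;> by_cases h1 : N.node s 1 ∈ A <;> simp only [h0, h1, if_true,
      if_false] <;> ring

end BipartiteNetwork

/-! ### Product unitaries and mixtures -/

theorem conjTranspose_tensorMatrix_mul_self {V : Type*} [Fintype V] [DecidableEq V] {ι : V → Type*}
    [∀ v, Fintype (ι v)] [∀ v, DecidableEq (ι v)] {U : ∀ v, Matrix (ι v) (ι v) ℂ}
    (hU : ∀ v, (U v)ᴴ * U v = 1) : (tensorMatrix U)ᴴ * tensorMatrix U = 1 := by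
  rw [conjTranspose_tensorMatrix, tensorMatrix_mul, funext hU, tensorMatrix_one]

theorem tensorMatrix_anticommute {V : Type*} [Fintype V] [DecidableEq V] {ι : V → Type*}
    [∀ v, Fintype (ι v)] {R P : ∀ v, Matrix (ι v) (ι v) ℂ} (i : V)
    (hi : R i * P i = -(P i * R i)) (hne : ∀ j ≠ i, R j * P j = P j * R j) :
    tensorMatrix R * tensorMatrix P = -(tensorMatrix P * tensorMatrix R) := by
  rw [tensorMatrix_mul, tensorMatrix_mul]
  ext x y
  rw [Matrix.neg_apply, tensorMatrix_apply, tensorMatrix_apply,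
    ← Finset.mul_prod_erase _ _ (Finset.mem_univ i),
    ← Finset.mul_prod_erase _ _ (Finset.mem_univ i), hi, Matrix.neg_apply, neg_mul]
  congr 2
  exact Finset.prod_congr rfl fun j hj => by rw [hne j (Finset.ne_of_mem_erase hj)]

/-- If a mixture of states attains expectation one for a unitary, then so does every state of the
mixture. -/
theorem re_trace_eq_one_of_hasSum {ι Λ : Type*} [Fintype ι] [DecidableEq ι] {p : Λ → ℝ}
    {η : Λ → Matrix ι ι ℂ} {ρ U : Matrix ι ι ℂ} (hη : ∀ l, IsDensityMatrix (η l))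
    (hp : ∀ l, 0 ≤ p l) (hp1 : HasSum p 1) (hρ : HasSum (fun l => (p l : ℂ) • η l) ρ)
    (hU : Uᴴ * U = 1) (h : (ρ * U).trace = 1) {l : Λ} (hl : p l ≠ 0) :
    (η l * U).trace.re = 1 := by
  let f : Matrix ι ι ℂ →+ ℝ :=
    { toFun := fun M => (M * U).trace.re
      map_zero' := by simp
      map_add' := fun M N => by simp [Matrix.add_mul] }
  have hf : Continuous f :=
    Complex.continuous_re.comp (Continuous.matrix_trace (continuous_id.matrix_mul continuous_const))
  have h1 : HasSum (fun l => p l * (η l * U).trace.re) 1 := by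
    have := hρ.map f hf
    simpa [f, Function.comp_def, h] using this
  -- The weighted deficits are nonnegative and sum to zero, so each of them vanishes.
  have h2 : HasSum (fun l => p l * (1 - (η l * U).trace.re)) 0 := by
    simpa [mul_sub] using hp1.sub h1
  have h3 := congrFun ((hasSum_zero_iff_of_nonneg fun l =>
    mul_nonneg (hp l) (sub_nonneg.2 (re_trace_mul_unitary_le (hη l) hU))).1 h2) l
  have h4 := (mul_eq_zero.1 h3).resolve_left hl
  linarith

/-! ### The cutting argument -/

namespace BipartiteNetwork

variable {V : Type*} [Fintype V] [DecidableEq V] (N : BipartiteNetwork V)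
  {d : N.Source → Fin 2 → ℕ}

/-- Cut the sources in a set. -/
noncomputable def cutOn (c : N.Source → Prop)
    (σ : ∀ s, Matrix (∀ b, Fin (d s b)) (∀ b, Fin (d s b)) ℂ) :
    ∀ s, Matrix (∀ b, Fin (d s b)) (∀ b, Fin (d s b)) ℂ :=
  open scoped Classical in fun s => if c s then cut (σ s) else σ s

theorem isDensityMatrix_cutOn (c : N.Source → Prop)
    {σ : ∀ s, Matrix (∀ b, Fin (d s b)) (∀ b, Fin (d s b)) ℂ}
    (hσ : ∀ s, IsDensityMatrix (σ s)) (s : N.Source) : IsDensityMatrix (N.cutOn c σ s) := by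
  unfold cutOn
  split_ifs
  · exact isDensityMatrix_cut (hσ s)
  · exact hσ s

/-- Cutting further sources does not change the expectation of a product observable, if each of
these sources has a subsystem which is sent to a party where the observable is trivial. -/
theorem trace_cutOn {σ : ∀ s, Matrix (∀ b, Fin (d s b)) (∀ b, Fin (d s b)) ℂ}
    (hσ : ∀ s, IsDensityMatrix (σ s)) {o : V → Type*} [∀ v, Fintype (o v)] [∀ v, DecidableEq (o v)]
    {E : ∀ v, Matrix (N.LocalIndex d v) (N.LocalIndex d v) ℂ →ₗ[ℂ] Matrix (o v) (o v) ℂ}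
    (hE : ∀ v, IsChannel (E v)) {c c' : N.Source → Prop} (hc : ∀ s, c s → c' s)
    {O : ∀ v, Matrix (o v) (o v) ℂ} (hO : ∀ s, c' s → ¬ c s → ∃ b, O (N.node s b) = 1) :
    (applyLocal E (N.sourceState (N.cutOn c' σ)) * tensorMatrix O).trace =
      (applyLocal E (N.sourceState (N.cutOn c σ)) * tensorMatrix O).trace := by
  rw [trace_applyLocal_mul, trace_applyLocal_mul]
  refine N.pairing_sourceState_congr fun s => ?_
  by_cases h : c s
  · left; simp [cutOn, h, hc s h]
  · by_cases h' : c' s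
    · right
      obtain ⟨b, hb⟩ := hO s h' h
      refine ⟨b, by rw [hb, (hE _).response_one], fun x y => ?_⟩
      simp only [cutOn, h, h', if_true, if_false]
      exact sum_update_cut (hσ s) b x y
    · left; simp [cutOn, h, h']

theorem cutOn_false (σ : ∀ s, Matrix (∀ b, Fin (d s b)) (∀ b, Fin (d s b)) ℂ) :
    N.cutOn (fun _ => False) σ = σ := by
  funext s; simp [cutOn]

/-- If all sources between `A` and its complement are cut, then expectations of product observables
factorize. -/
theorem trace_cutOn_crossing (A : Finset V)
    {σ : ∀ s, Matrix (∀ b, Fin (d s b)) (∀ b, Fin (d s b)) ℂ}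
    (hσ : ∀ s, IsDensityMatrix (σ s)) {o : V → Type*} [∀ v, Fintype (o v)] [∀ v, DecidableEq (o v)]
    {E : ∀ v, Matrix (N.LocalIndex d v) (N.LocalIndex d v) ℂ →ₗ[ℂ] Matrix (o v) (o v) ℂ}
    (hE : ∀ v, IsChannel (E v)) (O : ∀ v, Matrix (o v) (o v) ℂ)
    {η : Matrix (∀ v, o v) (∀ v, o v) ℂ}
    (hη : η = applyLocal E
      (N.sourceState (N.cutOn (fun s => ¬ (N.node s 0 ∈ A ↔ N.node s 1 ∈ A)) σ))) :
    (η * tensorMatrix O).trace = (η * tensorMatrix fun v => if v ∈ A then O v else 1).trace *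
      (η * tensorMatrix fun v => if v ∈ A then 1 else O v).trace := by
  have h := pairing_factor A (N.sourceState_mix_mul A
    (σ := N.cutOn (fun s => ¬ (N.node s 0 ∈ A ↔ N.node s 1 ∈ A)) σ) fun s => by
      by_cases hs : N.node s 0 ∈ A ↔ N.node s 1 ∈ A
      · exact Or.inl hs
      · refine Or.inr ⟨Matrix.of fun i j => ∑ k, σ s (pair i k) (pair j k),
          Matrix.of fun i j => ∑ k, σ s (pair k i) (pair k j), fun x y => ?_⟩
        simp only [cutOn, hs, not_false_eq_true, if_true]
        rfl) fun v => response (E v) (O v)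
  rw [_root_.QuantumNetwork.pairing_one,
    (N.isDensityMatrix_sourceState (N.isDensityMatrix_cutOn _ hσ)).2, mul_one] at h
  subst hη
  simp only [trace_applyLocal_mul, h, apply_ite (response (E _)), (hE _).response_one]

/-- Two-stage cutting is essential: `S` itself need not survive the cut of all crossing sources, but
`S * T` does once it is known to have expectation one after the first stage. -/
theorem false_of_stabilized {σ : ∀ s, Matrix (∀ b, Fin (d s b)) (∀ b, Fin (d s b)) ℂ}
    (hσ : ∀ s, IsDensityMatrix (σ s)) {o : V → Type*} [∀ v, Fintype (o v)] [∀ v, DecidableEq (o v)]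
    {E : ∀ v, Matrix (N.LocalIndex d v) (N.LocalIndex d v) ℂ →ₗ[ℂ] Matrix (o v) (o v) ℂ}
    (hE : ∀ v, IsChannel (E v)) {S T R : ∀ v, Matrix (o v) (o v) ℂ}
    (hS : ∀ v, (S v)ᴴ * S v = 1) (hT : ∀ v, (T v)ᴴ * T v = 1) (hR : ∀ v, (R v)ᴴ * R v = 1)
    (hSη : (applyLocal E (N.sourceState σ) * tensorMatrix S).trace.re = 1)
    (hTη : (applyLocal E (N.sourceState σ) * tensorMatrix T).trace.re = 1)
    (hRη : (applyLocal E (N.sourceState σ) * tensorMatrix R).trace.re = 1)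
    (A : Finset V) (hTA : ∀ v ∈ A, T v = 1) (hST : ∀ v ∉ A, S v = 1 ∨ S v * T v = 1)
    (hRS : tensorMatrix R * tensorMatrix (fun v => if v ∈ A then S v else 1) =
      -(tensorMatrix (fun v => if v ∈ A then S v else 1) * tensorMatrix R)) : False := by
  let c₂ : N.Source → Prop := fun s => ¬ (N.node s 0 ∈ A ↔ N.node s 1 ∈ A)
  -- Exactly the crossing sources that can be cut without affecting `S` at the outer end; `T` is
  -- protected by the end in `A`.
  let c₁ : N.Source → Prop := fun s => c₂ s ∧ ∃ b, N.node s b ∉ A ∧ S (N.node s b) = 1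
  have hin : ∀ s, c₂ s → ∃ b, N.node s b ∈ A := fun s hs => by
    by_contra! h
    exact hs (by simp [h])
  have hout : ∀ s, c₂ s → ∃ b, N.node s b ∉ A := fun s hs => by
    by_contra! h
    exact hs (by simp [h])
  have hdens : ∀ c, IsDensityMatrix (applyLocal E (N.sourceState (N.cutOn c σ))) := fun c =>
    isDensityMatrix_applyLocal hE (N.isDensityMatrix_sourceState (N.isDensityMatrix_cutOn c hσ))
  rw [← N.cutOn_false σ] at hSη hTη hRη
  have hS₁ : (applyLocal E (N.sourceState (N.cutOn c₁ σ)) * tensorMatrix S).trace.re = 1 := by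
    rw [← hSη, N.trace_cutOn hσ hE (fun _ => False.elim) fun s hs _ => ?_]
    obtain ⟨-, b, -, hb⟩ := hs
    exact ⟨b, hb⟩
  have hT₁ : (applyLocal E (N.sourceState (N.cutOn c₁ σ)) * tensorMatrix T).trace.re = 1 := by
    rw [← hTη, N.trace_cutOn hσ hE (fun _ => False.elim) fun s hs _ => ?_]
    obtain ⟨b, hb⟩ := hin s hs.1
    exact ⟨b, hTA _ hb⟩
  have hST₁ := trace_mul_mul_eq_one (hdens c₁) (conjTranspose_tensorMatrix_mul_self hS)
    (conjTranspose_tensorMatrix_mul_self hT) hS₁ hT₁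
  -- A source in `c₂` but not `c₁` has its outer end where `S` is nontrivial, so `hST` makes `S * T`
  -- trivial there.
  rw [tensorMatrix_mul, ← N.trace_cutOn hσ hE (c' := c₂) (fun s hs => hs.1) fun s hs hs' => by
      obtain ⟨b, hb⟩ := hout s hs
      exact ⟨b, (hST _ hb).resolve_left fun h => hs' ⟨hs, b, hb, h⟩⟩,
    N.trace_cutOn_crossing A hσ hE _ rfl] at hST₁
  have hP : (fun v => if v ∈ A then S v * T v else 1) = fun v => if v ∈ A then S v else 1 := by
    funext v
    by_cases h : v ∈ A
    · simp [h, hTA v h]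
    · simp [h]
  -- The restriction of `S` is trivial outside `A`, so all cuts can be undone; `R` need only
  -- stabilize the uncut state.
  rw [hP, N.trace_cutOn hσ hE (c := fun _ => False) (c' := c₂) (fun _ => False.elim) fun s hs _ => ?_,
    trace_mul_eq_zero_of_anticommute (hdens _) (conjTranspose_tensorMatrix_mul_self hR) hRη hRS,
    zero_mul] at hST₁
  · exact zero_ne_one hST₁
  · obtain ⟨b, hb⟩ := hout s hs
    exact ⟨b, if_neg hb⟩

/-- A state which is stabilized by product unitaries `S`, `T` and `R`, such that `T` is trivial on
`A`, the product `S * T` is trivial wherever `S` is nontrivial outside `A`, and `R` anticommutes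
with the restriction of `S` to `A`, cannot be generated. -/
theorem not_generates_of_stabilized {ρ : Matrix (V → Fin 2) (V → Fin 2) ℂ}
    {S T R : V → Matrix (Fin 2) (Fin 2) ℂ}
    (hS : ∀ v, (S v)ᴴ * S v = 1) (hT : ∀ v, (T v)ᴴ * T v = 1) (hR : ∀ v, (R v)ᴴ * R v = 1)
    (hSρ : (ρ * tensorMatrix S).trace = 1) (hTρ : (ρ * tensorMatrix T).trace = 1)
    (hRρ : (ρ * tensorMatrix R).trace = 1)
    (A : Finset V) (hTA : ∀ v ∈ A, T v = 1) (hST : ∀ v ∉ A, S v = 1 ∨ S v * T v = 1)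
    (hRS : tensorMatrix R * tensorMatrix (fun v => if v ∈ A then S v else 1) =
      -(tensorMatrix (fun v => if v ∈ A then S v else 1) * tensorMatrix R)) :
    ¬ N.Generates ρ := by
  rintro ⟨d, σ, Λ, p, E, hσ, hp, hp1, hE, hρ⟩
  have hη := fun l => isDensityMatrix_applyLocal (hE l) (N.isDensityMatrix_sourceState hσ)
  obtain ⟨l, hl⟩ : ∃ l, p l ≠ 0 := by
    by_contra! h
    rw [funext h] at hp1
    exact zero_ne_one (hasSum_zero.unique hp1)
  have h : ∀ U : V → Matrix (Fin 2) (Fin 2) ℂ, (∀ v, (U v)ᴴ * U v = 1) →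
      (ρ * tensorMatrix U).trace = 1 → _ := fun U hU h =>
    re_trace_eq_one_of_hasSum hη hp hp1 hρ (conjTranspose_tensorMatrix_mul_self hU) h hl
  exact N.false_of_stabilized hσ (hE l) hS hT hR (h S hS hSρ) (h T hT hTρ) (h R hR hRρ) A hTA hST hRS

end BipartiteNetwork

/-! ### Pauli matrices and graph states -/

theorem trace_pureState_mul {ι : Type*} [Fintype ι] {ψ : ι → ℂ} (hψ : star ψ ⬝ᵥ ψ = 1)
    {U : Matrix ι ι ℂ} (hU : U.mulVec ψ = ψ) : (pureState ψ * U).trace = 1 := by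
  rw [Matrix.trace_mul_comm, pureState, Matrix.mul_vecMulVec, hU, Matrix.trace_vecMulVec,
    dotProduct_comm, hψ]

theorem pauliX_mul_self : pauliX * pauliX = 1 := by
  ext i j; fin_cases i <;> fin_cases j <;> simp [pauliX]

theorem pauliZ_mul_self : pauliZ * pauliZ = 1 := by
  ext i j; fin_cases i <;> fin_cases j <;> simp [pauliZ]

theorem pauliZ_mul_pauliX : pauliZ * pauliX = -(pauliX * pauliZ) := by
  ext i j; fin_cases i <;> fin_cases j <;> simp [pauliX, pauliZ]

theorem conjTranspose_pauliX : pauliXᴴ = pauliX := by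
  ext i j; fin_cases i <;> fin_cases j <;> simp [pauliX]

theorem conjTranspose_pauliZ : pauliZᴴ = pauliZ := by
  ext i j; fin_cases i <;> fin_cases j <;> simp [pauliZ]

section Graph

variable {V : Type*} [DecidableEq V] (G : SimpleGraph V) [DecidableRel G.Adj]

/-- The factor of the stabilizing operator of `i` at the vertex `j`. -/
def stabilizerFactor (i j : V) : Matrix (Fin 2) (Fin 2) ℂ :=
  if j = i then pauliX else if G.Adj i j then pauliZ else 1

theorem stabilizerFactor_self (i : V) : stabilizerFactor G i i = pauliX := if_pos rfl

variable {G}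

theorem stabilizerFactor_of_adj {i j : V} (h : G.Adj i j) : stabilizerFactor G i j = pauliZ := by
  rw [stabilizerFactor, if_neg h.ne', if_pos h]

theorem stabilizerFactor_of_not_adj {i j : V} (hne : j ≠ i) (h : ¬ G.Adj i j) :
    stabilizerFactor G i j = 1 := by
  rw [stabilizerFactor, if_neg hne, if_neg h]

theorem stabilizerFactor_unitary (i j : V) :
    (stabilizerFactor G i j)ᴴ * stabilizerFactor G i j = 1 := by
  unfold stabilizerFactor
  split_ifs
  · rw [conjTranspose_pauliX, pauliX_mul_self]
  · rw [conjTranspose_pauliZ, pauliZ_mul_self]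
  · simp

theorem stabilizerFactor_mul_unitary (i k j : V) :
    (stabilizerFactor G i j * stabilizerFactor G k j)ᴴ *
      (stabilizerFactor G i j * stabilizerFactor G k j) = 1 := by
  rw [Matrix.conjTranspose_mul, Matrix.mul_assoc, ← Matrix.mul_assoc _ (stabilizerFactor G i j),
    stabilizerFactor_unitary, Matrix.one_mul, stabilizerFactor_unitary]

theorem stabilizerFactor_mul_self (i j : V) :
    stabilizerFactor G i j * stabilizerFactor G i j = 1 := by
  unfold stabilizerFactor
  split_ifs
  · exact pauliX_mul_self
  · exact pauliZ_mul_self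
  · simp

variable [Fintype V] {ψ : (V → Fin 2) → ℂ}

theorem IsGraphState.trace_stabilizer (hψ : IsGraphState G ψ) (i : V) :
    (pureState ψ * tensorMatrix (stabilizerFactor G i)).trace = 1 :=
  trace_pureState_mul hψ.1 (hψ.2 i)

theorem IsGraphState.trace_stabilizer_mul (hψ : IsGraphState G ψ) (i k : V) :
    (pureState ψ * tensorMatrix fun j => stabilizerFactor G i j * stabilizerFactor G k j).trace =
      1 := by
  refine trace_pureState_mul hψ.1 ?_
  rw [← tensorMatrix_mul, ← Matrix.mulVec_mulVec]
  exact (congrArg _ (hψ.2 k)).trans (hψ.2 i)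

/-- `A` is the complement of the closed neighbourhood of `b`, exactly where the generator of `b` is
trivial. At common neighbours of `a` and `b` the two `Z` factors cancel. As `v` lies outside `A`,
the generator of `v` meets the restriction to `A` in a noncommuting way only at `a`. -/
theorem IsGraphState.not_generates_of_not_adj (hψ : IsGraphState G ψ) (N : BipartiteNetwork V)
    {a b v : V} (ha : G.Adj v a) (hb : G.Adj v b) (hab : a ≠ b) (hnadj : ¬ G.Adj a b) :
    ¬ N.Generates (pureState ψ) := by
  refine N.not_generates_of_stabilized (stabilizerFactor_unitary a) (stabilizerFactor_unitary b)
    (stabilizerFactor_unitary v) (hψ.trace_stabilizer a) (hψ.trace_stabilizer b)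
    (hψ.trace_stabilizer v) (Finset.univ.filter fun x => x ≠ b ∧ ¬ G.Adj b x) ?_ ?_ ?_
  · intro x hx
    obtain ⟨h1, h2⟩ := (Finset.mem_filter.1 hx).2
    exact stabilizerFactor_of_not_adj h1 h2
  · intro x hx
    by_cases hxb : x = b
    · subst hxb
      exact Or.inl (stabilizerFactor_of_not_adj hab.symm hnadj)
    · have hbx : G.Adj b x := by simpa [hxb] using hx
      have hxa : x ≠ a := by rintro rfl; exact hnadj hbx.symm
      by_cases hax : G.Adj a x
      · exact Or.inr (by
          rw [stabilizerFactor_of_adj hax, stabilizerFactor_of_adj hbx, pauliZ_mul_self])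
      · exact Or.inl (stabilizerFactor_of_not_adj hxa hax)
  · refine tensorMatrix_anticommute a ?_ fun x hxa => ?_
    · have : ¬ G.Adj b a := fun h => hnadj h.symm
      simp only [Finset.mem_filter, Finset.mem_univ, true_and, ne_eq, hab, not_false_eq_true, this,
        and_self, if_true, stabilizerFactor_self, stabilizerFactor_of_adj ha, pauliZ_mul_pauliX]
    · by_cases hx : x ≠ b ∧ ¬ G.Adj b x
      · have hxv : x ≠ v := by rintro rfl; exact hx.2 hb.symm
        simp only [Finset.mem_filter, Finset.mem_univ, true_and, hx, not_false_eq_true, and_self,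
          ne_eq, if_true, stabilizerFactor, if_neg hxa, if_neg hxv]
        split_ifs <;> simp
      · simp [hx]

/-- By `htrans`, `a` and `v` have the same closed neighbourhood, so the product of their generators
is trivial off these two vertices. With `A = {a}`, only `v` needs the cancellation in `S * T`, which
is the product of the generators of `a` and `b`. At `a`, `S` is `X * Z`, which anticommutes with the
`Z` of the generator of `b`. -/
theorem IsGraphState.not_generates_of_twins (hψ : IsGraphState G ψ) (N : BipartiteNetwork V)
    (htrans : ∀ v a b, G.Adj v a → G.Adj v b → a ≠ b → G.Adj a b)
    {a b v : V} (ha : G.Adj v a) (hb : G.Adj v b) (hab : a ≠ b) :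
    ¬ N.Generates (pureState ψ) := by
  have hadj := htrans v a b ha hb hab
  refine N.not_generates_of_stabilized (stabilizerFactor_mul_unitary a v)
    (stabilizerFactor_mul_unitary v b) (stabilizerFactor_unitary b) (hψ.trace_stabilizer_mul a v)
    (hψ.trace_stabilizer_mul v b) (hψ.trace_stabilizer b) {a} ?_ ?_ ?_
  · intro x hx
    rw [Finset.mem_singleton.1 hx, stabilizerFactor_of_adj ha, stabilizerFactor_of_adj hadj.symm,
      pauliZ_mul_self]
  · intro x hx
    rw [Finset.mem_singleton] at hx
    have hprod : stabilizerFactor G a x * stabilizerFactor G v x *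
        (stabilizerFactor G v x * stabilizerFactor G b x) =
        stabilizerFactor G a x * stabilizerFactor G b x := by
      rw [Matrix.mul_assoc, ← Matrix.mul_assoc (stabilizerFactor G v x),
        stabilizerFactor_mul_self, Matrix.one_mul]
    by_cases hxv : x = v
    · subst hxv
      right
      rw [hprod, stabilizerFactor_of_adj ha.symm, stabilizerFactor_of_adj hb.symm, pauliZ_mul_self]
    · left
      by_cases hax : G.Adj a x
      · rw [stabilizerFactor_of_adj hax,
          stabilizerFactor_of_adj (htrans a v x ha.symm hax (Ne.symm hxv)), pauliZ_mul_self]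
      · rw [stabilizerFactor_of_not_adj hx hax, stabilizerFactor_of_not_adj hxv
          fun h => hax (htrans v a x ha h (Ne.symm hx)), Matrix.one_mul]
  · refine tensorMatrix_anticommute a ?_ fun x hxa => ?_
    · simp only [Finset.mem_singleton, if_true, stabilizerFactor_self, stabilizerFactor_of_adj ha,
        stabilizerFactor_of_adj hadj.symm]
      rw [← Matrix.mul_assoc, pauliZ_mul_pauliX, Matrix.neg_mul]
    · simp [hxa]

/-- The graph state of a graph with a vertex of degree at least two cannot be generated in a
network with bipartite sources. -/
theorem IsGraphState.not_generates (hψ : IsGraphState G ψ) (N : BipartiteNetwork V) {v : V}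
    (hdeg : 1 < G.degree v) : ¬ N.Generates (pureState ψ) := by
  obtain ⟨a, ha, b, hb, hab⟩ := Finset.one_lt_card.1 hdeg
  rw [SimpleGraph.mem_neighborFinset] at ha hb
  by_cases h : ∀ v a b, G.Adj v a → G.Adj v b → a ≠ b → G.Adj a b
  · exact hψ.not_generates_of_twins N h ha hb hab
  · push Not at h
    obtain ⟨v, a, b, ha, hb, hab, hnadj⟩ := h
    exact hψ.not_generates_of_not_adj N ha hb hab hnadj

end Graph

end QuantumNetwork

/-- The hypothesis on the neighbourhood of `v` is not needed: the argument covers all graphs with a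
vertex of degree at least two. -/
theorem corollary5 {V : Type*} [Fintype V] [DecidableEq V] (G : SimpleGraph V)
    [DecidableRel G.Adj] (v : V) (hdeg : G.degree v = 4)
    (hpath : ¬ Nonempty (G.induce (G.neighborSet v) ≃g SimpleGraph.pathGraph 4))
    (ψ : (V → Fin 2) → ℂ) (hψ : QuantumNetwork.IsGraphState G ψ)
    (N : QuantumNetwork.BipartiteNetwork V) :
    ¬ N.Generates (QuantumNetwork.pureState ψ) :=
  hψ.not_generates N (by omega : 1 < G.degree v)
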